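/- Let all random vectors be defined on one probability space, with values in Euclidean spaces $\mathbb{R}^{d}$ of (arbitrary, possibly different) dimensions $d\ge 1$. All information quantities take values in $[0,\infty]$. **Definitions.** $\mathsf{I}(U;V):=\mathsf{D}_{\mathsf{KL}}(P_{U,V}\|P_U\otimes P_V)$ is mutual information, and $\mathsf{I}(U;V|W):=\int \mathsf{I}(U;V|W=w)\,\mathrm{d}P_W(w)$ is conditional mutual information, where $\mathsf{I}(U;V|W=w)$ is computed under the conditional law $P_{U,V|W=w}$. Let $\Theta,\Phi,\Psi,\Theta_i,\Phi_j,\Psi_k$ denote random directions, each uniformly distributed on the unit sphere $\mathbb{S}^{d-1}$ of the space of the variable that it multiplies, mutually independent and independent of all the data variables. The sliced mutual information is $$\mathsf{SI}(X;Y):=\mathsf{I}(\Theta^\intercal X;\Phi^\intercal Y\,|\,\Theta,\Phi),$$ and the joint and conditional versions are $$\mathsf{SI}(X,Y;Z):=\mathsf{I}(\Theta^\intercal X,\Phi^\intercal Y;\Psi^\intercal Z\,|\,\Theta,\Phi,\Psi),\qquad \mathsf{SI}(X;Y|Z):=\mathsf{I}(\Theta^\intercal X;\Phi^\intercal Y\,|\,\Theta,\Phi,\Psi,\Psi^\intercal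 Z),$$ $$\mathsf{SI}(X_1,\ldots,X_n;Y_1,\ldots,Y_m):=\mathsf{I}\big((\Theta_i^\intercal X_i)_i;(\Phi_j^\intercal Y_j)_j\,\big|\,(\Theta_i)_i,(\Phi_j)_j\big),$$ $$\mathsf{SI}(X;Y|Z_1,\ldots,Z_m):=\mathsf{I}\big(\Theta^\intercal X;\Phi^\intercal Y\,\big|\,\Theta,\Phi,(\Psi_k)_k,(\Psi_k^\intercal Z_k)_k\big).$$ Write $\pi^\theta(x):=\theta^\intercal x$, and $f_\sharp P$ for the pushforward of $P$ under $f$. **Proposition (SMI properties).** Let $X$ and $Y$ be random vectors in $\mathbb{R}^{d_x}$ and $\mathbb{R}^{d_y}$. 1. (Non-negativity) $\mathsf{SI}(X;Y)\ge 0$, with equality if and only if $X$ and $Y$ are independent. 2. (Bounds) $$\inf_{\theta\in\mathbb{S}^{d_x-1},\,\phi\in\mathbb{S}^{d_y-1}}\mathsf{I}(\theta^\intercal X;\phi^\intercal Y)\le \mathsf{SI}(X;Y)\le \sup_{\theta\in\mathbb{S}^{d_x-1},\,\phi\in\mathbb{S}^{d_y-1}}\mathsf{I}(\theta^\intercal X;\phi^\intercal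 Y)\le \mathsf{I}(X;Y).$$ 3. (KL divergence) $\mathsf{SI}(X;Y)=\mathbb{E}_{\Theta,\Phi}\Big[\mathsf{D}_{\mathsf{KL}}\big((\pi^\Theta,\pi^\Phi)_\sharp P_{X,Y}\,\big\|\,\pi^\Theta_\sharp P_X\otimes\pi^\Phi_\sharp P_Y\big)\Big]$. 4. (Chain rule) For any $n\ge 1$ and any random vectors $X_1,\ldots,X_n,Y$, $$\mathsf{SI}(X_1,\ldots,X_n;Y)=\mathsf{SI}(X_1;Y)+\sum_{i=2}^n\mathsf{SI}(X_i;Y\,|\,X_1,\ldots,X_{i-1}).$$ In particular, for any random vectors $X,Y,Z$, $\mathsf{SI}(X,Y;Z)=\mathsf{SI}(X;Z)+\mathsf{SI}(Y;Z|X)$. 5. (Tensorization) If the pairs $(X_1,Y_1),\ldots,(X_n,Y_n)$ of random vectors are mutually independent, then $$\mathsf{SI}(X_1,\ldots,X_n;Y_1,\ldots,Y_n)=\sum_{i=1}^n\mathsf{SI}(X_i;Y_i).$$ -/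

import Mathlib

open MeasureTheory ProbabilityTheory InformationTheory
open scoped ENNReal

noncomputable section

/-- The unit sphere `𝕊^{d-1}` of `ℝ^d`. -/
abbrev Sph (d : ℕ) : Type := Metric.sphere (0 : EuclideanSpace ℝ (Fin d)) 1

/-- The uniform distribution on `𝕊^{d-1}`: the surface measure divided by the surface area
(for `d = 0` the sphere is empty and this is the zero measure). -/
def unifSph (d : ℕ) : Measure (Sph d) :=
  ((volume : Measure (EuclideanSpace ℝ (Fin d))).toSphere Set.univ)⁻¹ •
    (volume : Measure (EuclideanSpace ℝ (Fin d))).toSphere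

instance unifSph.instIsZeroOrProbabilityMeasure (d : ℕ) :
    IsZeroOrProbabilityMeasure (unifSph d) := by
  unfold unifSph; infer_instance

/-- Slicing along `θ`: `x ↦ θᵀ x`. -/
def slice {d : ℕ} (θ : Sph d) (x : EuclideanSpace ℝ (Fin d)) : ℝ :=
  inner ℝ (θ : EuclideanSpace ℝ (Fin d)) x

/-- Mutual information `I(U;V) = D_KL(P_{U,V} ‖ P_U ⊗ P_V)`, with values in `[0, ∞]`. -/
def mutualInfo {Ω α β : Type*} [MeasurableSpace Ω] [MeasurableSpace α] [MeasurableSpace β]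
    (U : Ω → α) (V : Ω → β) (P : Measure Ω) : ℝ≥0∞ :=
  klDiv (P.map (fun ω => (U ω, V ω))) ((P.map U).prod (P.map V))

/-- Conditional mutual information `I(U;V|W) = ∫ I(U;V|W=w) dP_W(w)`, where `I(U;V|W=w)` is the
mutual information of the two coordinates under the regular conditional law of `(U,V)`
given `W = w`. -/
def condMutualInfo {Ω α β γ : Type*} [MeasurableSpace Ω]
    [MeasurableSpace α] [StandardBorelSpace α] [Nonempty α]
    [MeasurableSpace β] [StandardBorelSpace β] [Nonempty β] [MeasurableSpace γ]
    (U : Ω → α) (V : Ω → β) (W : Ω → γ) (P : Measure Ω) [IsFiniteMeasure P] : ℝ≥0∞ :=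
  ∫⁻ w, mutualInfo (Prod.fst : α × β → α) (Prod.snd : α × β → β)
    (condDistrib (fun ω => (U ω, V ω)) W P w) ∂(P.map W)

section Sliced

variable {Ω : Type*} [MeasurableSpace Ω]

/-- Sliced mutual information `SI(X;Y) = I(ΘᵀX; ΦᵀY | Θ, Φ)`. The directions `Θ`, `Φ` are the
sphere coordinates of `Ω × 𝕊 × 𝕊` under `P ⊗ Unif ⊗ Unif`, i.e. they are uniform,
independent of each other and of `(X, Y)`. -/
def slicedMI {dx dy : ℕ} (X : Ω → EuclideanSpace ℝ (Fin dx)) (Y : Ω → EuclideanSpace ℝ (Fin dy))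
    (P : Measure Ω) [IsFiniteMeasure P] : ℝ≥0∞ :=
  condMutualInfo
    (fun s : Ω × Sph dx × Sph dy => slice s.2.1 (X s.1))
    (fun s => slice s.2.2 (Y s.1))
    (fun s => s.2)
    (P.prod ((unifSph dx).prod (unifSph dy)))

/-- Joint sliced mutual information `SI(X,Y;Z) = I(ΘᵀX, ΦᵀY; ΨᵀZ | Θ, Φ, Ψ)`. -/
def jointSlicedMI {dx dy dz : ℕ} (X : Ω → EuclideanSpace ℝ (Fin dx))
    (Y : Ω → EuclideanSpace ℝ (Fin dy)) (Z : Ω → EuclideanSpace ℝ (Fin dz))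
    (P : Measure Ω) [IsFiniteMeasure P] : ℝ≥0∞ :=
  condMutualInfo
    (fun s : Ω × Sph dx × Sph dy × Sph dz => (slice s.2.1 (X s.1), slice s.2.2.1 (Y s.1)))
    (fun s => slice s.2.2.2 (Z s.1))
    (fun s => s.2)
    (P.prod ((unifSph dx).prod ((unifSph dy).prod (unifSph dz))))

/-- Conditional sliced mutual information `SI(X;Y|Z) = I(ΘᵀX; ΦᵀY | Θ, Φ, Ψ, ΨᵀZ)`. -/
def condSlicedMI {dx dy dz : ℕ} (X : Ω → EuclideanSpace ℝ (Fin dx))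
    (Y : Ω → EuclideanSpace ℝ (Fin dy)) (Z : Ω → EuclideanSpace ℝ (Fin dz))
    (P : Measure Ω) [IsFiniteMeasure P] : ℝ≥0∞ :=
  condMutualInfo
    (fun s : Ω × Sph dx × Sph dy × Sph dz => slice s.2.1 (X s.1))
    (fun s => slice s.2.2.1 (Y s.1))
    (fun s => (s.2, slice s.2.2.2 (Z s.1)))
    (P.prod ((unifSph dx).prod ((unifSph dy).prod (unifSph dz))))

/-- Joint sliced mutual information of two finite families:
`SI((Xᵢ)ᵢ; (Yⱼ)ⱼ) = I((Θᵢᵀ Xᵢ)ᵢ; (Φⱼᵀ Yⱼ)ⱼ | (Θᵢ)ᵢ, (Φⱼ)ⱼ)`, all directions being independent. -/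
def multiSlicedMI {ι κ : Type*} [Fintype ι] [Fintype κ] {dx : ι → ℕ} {dy : κ → ℕ}
    (X : ∀ i, Ω → EuclideanSpace ℝ (Fin (dx i))) (Y : ∀ j, Ω → EuclideanSpace ℝ (Fin (dy j)))
    (P : Measure Ω) [IsFiniteMeasure P] : ℝ≥0∞ :=
  condMutualInfo
    (fun s : Ω × (∀ i, Sph (dx i)) × (∀ j, Sph (dy j)) => fun i => slice (s.2.1 i) (X i s.1))
    (fun s => fun j => slice (s.2.2 j) (Y j s.1))
    (fun s => s.2)
    (P.prod ((Measure.pi fun i => unifSph (dx i)).prod (Measure.pi fun j => unifSph (dy j))))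

/-- Conditional sliced mutual information given a finite family:
`SI(X; Y | (Zₖ)ₖ) = I(ΘᵀX; ΦᵀY | Θ, Φ, (Ψₖ)ₖ, (Ψₖᵀ Zₖ)ₖ)`, all directions being independent. -/
def multiCondSlicedMI {κ : Type*} [Fintype κ] {dx dy : ℕ} {dz : κ → ℕ}
    (X : Ω → EuclideanSpace ℝ (Fin dx)) (Y : Ω → EuclideanSpace ℝ (Fin dy))
    (Z : ∀ k, Ω → EuclideanSpace ℝ (Fin (dz k)))
    (P : Measure Ω) [IsFiniteMeasure P] : ℝ≥0∞ :=
  condMutualInfo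
    (fun s : Ω × Sph dx × Sph dy × (∀ k, Sph (dz k)) => slice s.2.1 (X s.1))
    (fun s => slice s.2.2.1 (Y s.1))
    (fun s => (s.2, fun k => slice (s.2.2.2 k) (Z k s.1)))
    (P.prod ((unifSph dx).prod ((unifSph dy).prod (Measure.pi fun k => unifSph (dz k)))))

end Sliced

end

/-!
The directions `Θ, Φ, …` are independent of the data, so a regular conditional law given the
directions is the law of the data projected along frozen directions. Hence every sliced quantity is
the average, over the uniform distributions on the spheres, of an ordinary (conditional) mutual
information of real-valued projections: `condMutualInfo_snd` and
`aemeasurable_and_condMutualInfo_snd_prodMk`.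

This is the Kullback–Leibler form, and it gives the bounds by an infimum and a supremum over
directions, the last one combined with the data processing inequality. The chain rules and
tensorization follow by averaging the corresponding identities for frozen directions
(`mutualInfo_prodMk_left`, `mutualInfo_pi_fin_succ`, `mutualInfo_pi_of_iIndepFun`), after directions
that a term does not involve have been integrated out. Those identities come from the chain rule
for the relative entropy of composition products, together with `klDiv_compProd_right`, which
writes a conditional relative entropy as an average.

If the sliced mutual information vanishes, then the projections are independent for almost all pairs
of directions, and a Cramér–Wold argument with characteristic functions
(`indepFun_of_forall_slice`) yields the independence of the vectors themselves.
-/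

/-! ### Kullback–Leibler divergence of kernels and of product measures -/

section KL

variable {α β : Type*} {mα : MeasurableSpace α} {mβ : MeasurableSpace β}

theorem measurable_klDiv_kernel [MeasurableSpace.CountablyGenerated β]
    (κ η : Kernel α β) [IsFiniteKernel κ] [IsFiniteKernel η] :
    Measurable fun a => klDiv (κ a) (η a) := by
  classical
  have h : (fun a => klDiv (κ a) (η a)) = fun a => if κ a ≪ η a then
      ∫⁻ x, ENNReal.ofReal (klFun (κ.rnDeriv η a x).toReal) ∂(η a) else ∞ := by
    funext a
    rw [klDiv_eq_lintegral_klFun]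
    congr 1
    refine lintegral_congr_ae ?_
    filter_upwards [κ.rnDeriv_eq_rnDeriv_measure (η := η) (a := a)] with x hx
    rw [hx]
  rw [h]
  refine Measurable.ite (Kernel.measurableSet_absolutelyContinuous κ η) ?_ measurable_const
  refine Measurable.lintegral_kernel_prod_right' (κ := η)
    (f := fun p : α × β => ENNReal.ofReal (klFun (κ.rnDeriv η p.1 p.2).toReal)) ?_
  fun_prop

/-- Conditional relative entropy is the average of the fibrewise divergences. No absolute continuity
is assumed: if it fails on a set of positive measure, both sides are infinite. -/
theorem klDiv_compProd_right [MeasurableSpace.CountablyGenerated β]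
    (μ : Measure α) [IsFiniteMeasure μ]
    (κ η : Kernel α β) [IsFiniteKernel κ] [IsFiniteKernel η] :
    klDiv (μ ⊗ₘ κ) (μ ⊗ₘ η) = ∫⁻ a, klDiv (κ a) (η a) ∂μ := by
  by_cases hac : ∀ᵐ a ∂μ, κ a ≪ η a
  · have hac' : μ ⊗ₘ κ ≪ μ ⊗ₘ η := Measure.absolutelyContinuous_compProd_right_iff.mpr hac
    have hd : μ ⊗ₘ κ = (μ ⊗ₘ η).withDensity (fun p => κ.rnDeriv η p.1 p.2) := by
      rw [← Measure.compProd_withDensity (Kernel.measurable_rnDeriv κ η)]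
      refine Measure.compProd_congr ?_
      filter_upwards [hac] with a ha
      exact (Kernel.withDensity_rnDeriv_eq ha).symm
    have hr : (μ ⊗ₘ κ).rnDeriv (μ ⊗ₘ η) =ᵐ[μ ⊗ₘ η] fun p => κ.rnDeriv η p.1 p.2 := by
      conv_lhs => rw [hd]
      exact Measure.rnDeriv_withDensity _ (Kernel.measurable_rnDeriv κ η)
    rw [klDiv_eq_lintegral_klFun_of_ac hac']
    calc _ = ∫⁻ p, ENNReal.ofReal (klFun (κ.rnDeriv η p.1 p.2).toReal) ∂(μ ⊗ₘ η) := by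
          refine lintegral_congr_ae ?_
          filter_upwards [hr] with p hp
          rw [hp]
      _ = ∫⁻ a, ∫⁻ x, ENNReal.ofReal (klFun (κ.rnDeriv η a x).toReal) ∂(η a) ∂μ :=
          Measure.lintegral_compProd (by fun_prop)
      _ = _ := by
          refine lintegral_congr_ae ?_
          filter_upwards [hac] with a ha
          rw [klDiv_eq_lintegral_klFun_of_ac ha]
          refine lintegral_congr_ae ?_
          filter_upwards [κ.rnDeriv_eq_rnDeriv_measure (η := η) (a := a)] with x hx
          rw [hx]
  · rw [klDiv_of_not_ac (mt Measure.absolutelyContinuous_compProd_right_iff.mp hac)]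
    symm
    -- A finite average would make the divergence finite, hence absolute continuity hold, almost
    -- everywhere.
    by_contra hne
    refine hac ?_
    filter_upwards [ae_lt_top (measurable_klDiv_kernel κ η) hne] with a ha
    exact (klDiv_ne_top_iff.mp ha.ne).1

theorem klDiv_map_of_leftInverse (μ ν : Measure α) [IsFiniteMeasure μ] [IsFiniteMeasure ν]
    {f : α → β} {g : β → α} (hf : Measurable f) (hg : Measurable g)
    (hgf : Function.LeftInverse g f) :
    klDiv (μ.map f) (ν.map f) = klDiv μ ν := by
  refine le_antisymm (klDiv_map_le μ ν hf) ?_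
  have h := klDiv_map_le (μ.map f) (ν.map f) hg
  rwa [Measure.map_map hg hf, Measure.map_map hg hf, hgf.comp_eq_id, Measure.map_id,
    Measure.map_id] at h

/-- Relative entropy tensorizes: the chain rule with constant kernels. -/
theorem klDiv_prod [MeasurableSpace.CountablyGenerated β]
    (μ₁ ν₁ : Measure α) (μ₂ ν₂ : Measure β) [IsProbabilityMeasure μ₁] [IsProbabilityMeasure ν₁]
    [IsProbabilityMeasure μ₂] [IsProbabilityMeasure ν₂] :
    klDiv (μ₁.prod μ₂) (ν₁.prod ν₂) = klDiv μ₁ ν₁ + klDiv μ₂ ν₂ := by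
  rw [← Measure.compProd_const, ← Measure.compProd_const, klDiv_compProd_eq_add,
    klDiv_compProd_right]
  simp

theorem klDiv_pi_fin : ∀ {n : ℕ} {E : Fin n → Type*} [∀ i, MeasurableSpace (E i)]
    [∀ i, StandardBorelSpace (E i)] (μ ν : ∀ i, Measure (E i))
    [∀ i, IsProbabilityMeasure (μ i)] [∀ i, IsProbabilityMeasure (ν i)],
    klDiv (Measure.pi μ) (Measure.pi ν) = ∑ i, klDiv (μ i) (ν i)
  | 0, E, _, _, μ, ν, _, _ => by
    rw [Measure.pi_of_empty μ, Measure.pi_of_empty ν]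
    simp
  | n + 1, E, _, _, μ, ν, _, _ => by
    rw [← klDiv_map_of_leftInverse (Measure.pi μ) (Measure.pi ν)
      (MeasurableEquiv.piFinSuccAbove E 0).measurable
      (MeasurableEquiv.piFinSuccAbove E 0).symm.measurable
      (MeasurableEquiv.piFinSuccAbove E 0).left_inv,
      (measurePreserving_piFinSuccAbove μ 0).map_eq, (measurePreserving_piFinSuccAbove ν 0).map_eq,
      klDiv_prod, klDiv_pi_fin, Fin.sum_univ_succ]
    rfl

end KL

/-! ### Mutual information and conditional mutual information -/

section MutualInfo

variable {Ω α β γ T : Type*} [MeasurableSpace Ω] [MeasurableSpace α] [MeasurableSpace β]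
  [MeasurableSpace γ] [MeasurableSpace T]

theorem mutualInfo_fst_snd (ρ : Measure (α × β)) :
    mutualInfo (Prod.fst : α × β → α) (Prod.snd : α × β → β) ρ = klDiv ρ (ρ.fst.prod ρ.snd) := by
  simp [mutualInfo, Measure.fst, Measure.snd]

/-- Mutual information depends only on the joint law. -/
theorem mutualInfo_eq_map (P : Measure Ω) {U : Ω → α} {V : Ω → β} (hU : Measurable U)
    (hV : Measurable V) :
    mutualInfo U V P =
      mutualInfo (Prod.fst : α × β → α) (Prod.snd : α × β → β) (P.map fun ω => (U ω, V ω)) := by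
  rw [mutualInfo_fst_snd, Measure.fst_map_prodMk hV, Measure.snd_map_prodMk hU, mutualInfo]

theorem measurable_mutualInfo_kernel [MeasurableSpace.CountablyGenerated α]
    [MeasurableSpace.CountablyGenerated β] (κ : Kernel T (α × β)) [IsFiniteKernel κ] :
    Measurable fun t => mutualInfo (Prod.fst : α × β → α) (Prod.snd : α × β → β) (κ t) := by
  have h := measurable_klDiv_kernel κ (κ.fst ×ₖ κ.snd)
  convert! h using 1
  funext t
  rw [mutualInfo_fst_snd, Kernel.prod_apply, Kernel.fst_apply, Kernel.snd_apply]
  rfl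

/-- Data processing inequality. -/
theorem mutualInfo_comp_le {α' β' : Type*} [MeasurableSpace α'] [MeasurableSpace β']
    (P : Measure Ω) [IsFiniteMeasure P] {U : Ω → α} {V : Ω → β} (hU : Measurable U)
    (hV : Measurable V) {f : α → α'} {g : β → β'} (hf : Measurable f) (hg : Measurable g) :
    mutualInfo (fun ω => f (U ω)) (fun ω => g (V ω)) P ≤ mutualInfo U V P := by
  have h := klDiv_map_le (P.map fun ω => (U ω, V ω)) ((P.map U).prod (P.map V)) (hf.prodMap hg)
  rwa [Measure.map_map (by fun_prop) (by fun_prop), ← Measure.map_prod_map _ _ hf hg,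
    Measure.map_map hf hU, Measure.map_map hg hV] at h

/-- Mutual information is unchanged by relabelling the values of the variables, even by
non-surjective maps, as long as the relabelling has a measurable left inverse. -/
theorem mutualInfo_comp_of_leftInverse {α' β' : Type*} [MeasurableSpace α'] [MeasurableSpace β']
    (P : Measure Ω) [IsFiniteMeasure P] {U : Ω → α} {V : Ω → β} (hU : Measurable U)
    (hV : Measurable V) {f : α → α'} {g : β → β'} (hf : Measurable f) (hg : Measurable g)
    {f' : α' → α} {g' : β' → β} (hf' : Measurable f') (hg' : Measurable g')
    (hff' : Function.LeftInverse f' f) (hgg' : Function.LeftInverse g' g) :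
    mutualInfo (fun ω => f (U ω)) (fun ω => g (V ω)) P = mutualInfo U V P := by
  refine le_antisymm (mutualInfo_comp_le P hU hV hf hg) ?_
  have h := mutualInfo_comp_le P (hf.comp hU) (hg.comp hV) hf' hg'
  have e1 : (fun ω => f' ((f ∘ U) ω)) = U := funext fun ω => hff' (U ω)
  have e2 : (fun ω => g' ((g ∘ V) ω)) = V := funext fun ω => hgg' (V ω)
  rw [e1, e2] at h
  exact h

theorem mutualInfo_eq_zero_iff (P : Measure Ω) [IsFiniteMeasure P] {U : Ω → α} {V : Ω → β}
    (hU : Measurable U) (hV : Measurable V) : mutualInfo U V P = 0 ↔ IndepFun U V P := by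
  rw [mutualInfo, klDiv_eq_zero_iff,
    indepFun_iff_map_prod_eq_prod_map_map hU.aemeasurable hV.aemeasurable]

/-- The laws of the sections `F (·, t)` of a jointly measurable function, as a kernel in `t`. -/
noncomputable def sectionLaw (P : Measure Ω) [SFinite P] (F : Ω × T → α) (hF : Measurable F) :
    Kernel T α where
  toFun t := P.map fun ω => F (ω, t)
  measurable' := by
    refine Measure.measurable_of_measurable_coe _ fun s hs => ?_
    have h : (fun t => (P.map fun ω => F (ω, t)) s) =
        fun t => P ((fun ω => (ω, t)) ⁻¹' (F ⁻¹' s)) := by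
      funext t
      rw [Measure.map_apply (by fun_prop) hs]
      rfl
    rw [h]
    exact measurable_measure_prodMk_right (hF hs)

theorem sectionLaw_apply (P : Measure Ω) [SFinite P] (F : Ω × T → α) (hF : Measurable F) (t : T) :
    sectionLaw P F hF t = P.map fun ω => F (ω, t) := rfl

instance (P : Measure Ω) [IsProbabilityMeasure P] (F : Ω × T → α) (hF : Measurable F) :
    IsMarkovKernel (sectionLaw P F hF) :=
  ⟨fun t => by
    rw [sectionLaw_apply]
    exact Measure.isProbabilityMeasure_map (by fun_prop)⟩

theorem compProd_sectionLaw (P : Measure Ω) [IsProbabilityMeasure P] (τ : Measure T) [SFinite τ]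
    (F : Ω × T → α) (hF : Measurable F) :
    τ ⊗ₘ sectionLaw P F hF = (P.prod τ).map fun s => (s.2, F s) := by
  ext s hs
  rw [Measure.compProd_apply hs, Measure.map_apply (by fun_prop) hs,
    Measure.prod_apply_symm ((by fun_prop : Measurable fun s : Ω × T => (s.2, F s)) hs)]
  refine lintegral_congr fun t => ?_
  rw [sectionLaw_apply, Measure.map_apply (by fun_prop) (measurable_prodMk_left hs)]
  rfl

/-- Conditioning on an independent variable `t` amounts to freezing `t` and averaging: the law of
the sections at `t` is a version of the conditional law. -/
theorem condMutualInfo_snd [StandardBorelSpace α] [Nonempty α] [StandardBorelSpace β] [Nonempty β]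
    (P : Measure Ω) [IsProbabilityMeasure P] (τ : Measure T) [IsFiniteMeasure τ]
    {U : Ω × T → α} {V : Ω × T → β} (hU : Measurable U) (hV : Measurable V) :
    condMutualInfo U V (fun s => s.2) (P.prod τ) =
      ∫⁻ t, mutualInfo (fun ω => U (ω, t)) (fun ω => V (ω, t)) P ∂τ := by
  have hm : (P.prod τ).map (fun s => s.2) = τ := by simp
  have h := condDistrib_ae_eq_of_measure_eq_compProd (μ := P.prod τ) (fun s : Ω × T => s.2)
    (Y := fun s => (U s, V s)) (by fun_prop)
    (κ := sectionLaw P (fun s => (U s, V s)) (by fun_prop)) (by rw [hm, compProd_sectionLaw])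
  rw [condMutualInfo]
  rw [hm] at h ⊢
  refine lintegral_congr_ae ?_
  filter_upwards [h] with t ht
  rw [ht, sectionLaw_apply, ← mutualInfo_eq_map P (U := fun ω => U (ω, t)) (V := fun ω => V (ω, t))
    (by fun_prop) (by fun_prop)]

theorem measurable_mutualInfo_section [MeasurableSpace.CountablyGenerated α]
    [MeasurableSpace.CountablyGenerated β]
    (P : Measure Ω) [IsProbabilityMeasure P]
    {U : Ω × T → α} {V : Ω × T → β} (hU : Measurable U) (hV : Measurable V) :
    Measurable fun t => mutualInfo (fun ω => U (ω, t)) (fun ω => V (ω, t)) P := by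
  have h := measurable_mutualInfo_kernel (sectionLaw P (fun s => (U s, V s)) (by fun_prop))
  convert! h using 1
  funext t
  rw [sectionLaw_apply, ← mutualInfo_eq_map P (U := fun ω => U (ω, t)) (V := fun ω => V (ω, t))
    (by fun_prop) (by fun_prop)]

/-- Conditioning on an independent variable `t` together with a variable `W` that may depend on `t`
amounts to freezing `t`, conditioning on the section of `W`, and averaging. Almost everywhere
measurability of the integrand is part of the claim because it is not automatic: for each `t` the
conditional law given the section of `W` is chosen separately, and only its agreement, for almost
every `t`, with the sections of one kernel makes it measurable. -/
theorem aemeasurable_and_condMutualInfo_snd_prodMk [StandardBorelSpace α] [Nonempty α]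
    [StandardBorelSpace β] [Nonempty β] [MeasurableSpace.CountablyGenerated γ]
    (P : Measure Ω) [IsProbabilityMeasure P] (τ : Measure T) [IsFiniteMeasure τ]
    {U : Ω × T → α} {V : Ω × T → β} {W : Ω × T → γ}
    (hU : Measurable U) (hV : Measurable V) (hW : Measurable W) :
    AEMeasurable (fun t => condMutualInfo (fun ω => U (ω, t)) (fun ω => V (ω, t))
        (fun ω => W (ω, t)) P) τ ∧
    condMutualInfo U V (fun s => (s.2, W s)) (P.prod τ) =
      ∫⁻ t, condMutualInfo (fun ω => U (ω, t)) (fun ω => V (ω, t)) (fun ω => W (ω, t)) P ∂τ := by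
  set F : Ω × T → α × β := fun s => (U s, V s) with hF_def
  have hF : Measurable F := by fun_prop
  set K := condDistrib F (fun s => (s.2, W s)) (P.prod τ) with hK
  have hG : (P.prod τ).map (fun s => (s.2, W s)) = τ ⊗ₘ sectionLaw P W hW :=
    (compProd_sectionLaw P τ W hW).symm
  -- Both sides are the law of `(t, W, F)`; uniqueness of disintegrations then identifies, for almost
  -- every `t`, the joint law of the sections of `W` and `F` with a step of the sections of `K`.
  have hdis : τ ⊗ₘ sectionLaw P (fun s => (W s, F s)) (by fun_prop) =
      τ ⊗ₘ (sectionLaw P W hW ⊗ₖ K) := by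
    rw [← Measure.compProd_assoc', ← hG, hK, compProd_map_condDistrib (by fun_prop),
      compProd_sectionLaw, Measure.map_map (by fun_prop) (by fun_prop)]
    rfl
  have hsec := Kernel.ae_eq_of_compProd_eq hdis
  have hmeas : Measurable fun p : T × γ =>
      mutualInfo (Prod.fst : α × β → α) (Prod.snd : α × β → β) (K p) :=
    measurable_mutualInfo_kernel K
  have hcond : (fun t => ∫⁻ w, mutualInfo (Prod.fst : α × β → α) (Prod.snd : α × β → β) (K (t, w))
        ∂(sectionLaw P W hW t)) =ᵐ[τ]
      fun t => condMutualInfo (fun ω => U (ω, t)) (fun ω => V (ω, t)) (fun ω => W (ω, t)) P := by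
    filter_upwards [hsec] with t ht
    rw [Kernel.compProd_apply_eq_compProd_sectR, sectionLaw_apply, sectionLaw_apply] at ht
    have h := condDistrib_ae_eq_of_measure_eq_compProd (μ := P) (fun ω => W (ω, t))
      (Y := fun ω => F (ω, t)) (by fun_prop) ht
    rw [condMutualInfo, sectionLaw_apply]
    refine lintegral_congr_ae ?_
    filter_upwards [h] with w hw
    rw [hF_def] at hw
    rw [hw]
    rfl
  refine ⟨⟨_, hmeas.lintegral_kernel_prod_right' (κ := sectionLaw P W hW), hcond.symm⟩, ?_⟩
  rw [condMutualInfo, hG, Measure.lintegral_compProd hmeas]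
  exact lintegral_congr_ae hcond

/-- Two conditionally independent steps can be drawn one after the other. -/
theorem map_compProd_prod {β₁ β₂ : Type*} [MeasurableSpace β₁] [MeasurableSpace β₂]
    (μ : Measure α) [SFinite μ] (κ : Kernel α β₁) (η : Kernel α β₂) [IsSFiniteKernel κ]
    [IsSFiniteKernel η] :
    (μ ⊗ₘ (κ ×ₖ η)).map (fun p => ((p.1, p.2.2), p.2.1)) =
      (μ ⊗ₘ η) ⊗ₘ Kernel.prodMkRight β₂ κ := by
  ext s hs
  have hm : Measurable fun p : α × β₁ × β₂ => ((p.1, p.2.2), p.2.1) := by fun_prop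
  rw [Measure.map_apply hm hs, Measure.compProd_apply (hm hs), Measure.compProd_apply hs,
    Measure.lintegral_compProd (Kernel.measurable_kernel_prodMk_left hs)]
  refine lintegral_congr fun a => ?_
  rw [Kernel.prod_apply, Measure.prod_apply_symm (measurable_prodMk_left (hm hs))]
  rfl

theorem map_prod_compProd {β₁ β₂ : Type*} [MeasurableSpace β₁] [MeasurableSpace β₂]
    (μ : Measure α) [SFinite μ] (κ : Kernel α β₁) [IsSFiniteKernel κ] (ν : Measure β₂)
    [SFinite ν] :
    ((μ ⊗ₘ κ).prod ν).map (fun p => ((p.1.1, p.2), p.1.2)) =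
      (μ.prod ν) ⊗ₘ Kernel.prodMkRight β₂ κ := by
  ext s hs
  have hm : Measurable fun p : (α × β₁) × β₂ => ((p.1.1, p.2), p.1.2) := by fun_prop
  rw [Measure.map_apply hm hs, Measure.prod_apply_symm (hm hs), Measure.compProd_apply hs,
    lintegral_prod_symm' _ (Kernel.measurable_kernel_prodMk_left hs)]
  refine lintegral_congr fun a => ?_
  rw [Measure.compProd_apply (measurable_prodMk_right (hm hs))]
  rfl

/-- Conditional mutual information is a single divergence, between the joint law and the law that
makes `U` and `V` conditionally independent given `W`. -/
theorem condMutualInfo_eq_klDiv [StandardBorelSpace α] [Nonempty α] [StandardBorelSpace β]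
    [Nonempty β] (P : Measure Ω) [IsFiniteMeasure P] {U : Ω → α} {V : Ω → β} (W : Ω → γ)
    (hU : Measurable U) (hV : Measurable V) :
    condMutualInfo U V W P = klDiv (P.map fun ω => (W ω, U ω, V ω))
      (P.map W ⊗ₘ (condDistrib U W P ×ₖ condDistrib V W P)) := by
  have h := compProd_map_condDistrib (mβ := ‹_›) (μ := P) (X := W)
    (Y := fun ω => (U ω, V ω)) (by fun_prop)
  rw [← h, klDiv_compProd_right, condMutualInfo]
  refine lintegral_congr_ae ?_
  have h1 := condDistrib_comp (mβ := ‹_›) (μ := P) W (Y := fun ω => (U ω, V ω)) (by fun_prop)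
    (f := Prod.fst) (by fun_prop)
  have h2 := condDistrib_comp (mβ := ‹_›) (μ := P) W (Y := fun ω => (U ω, V ω)) (by fun_prop)
    (f := Prod.snd) (by fun_prop)
  filter_upwards [h1, h2] with w hw1 hw2
  rw [mutualInfo_fst_snd, Kernel.prod_apply]
  have e1 : condDistrib U W P w = (condDistrib (fun ω => (U ω, V ω)) W P w).fst := by
    rw [Measure.fst, ← Kernel.map_apply _ measurable_fst, ← hw1]
    rfl
  have e2 : condDistrib V W P w = (condDistrib (fun ω => (U ω, V ω)) W P w).snd := by
    rw [Measure.snd, ← Kernel.map_apply _ measurable_snd, ← hw2]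
    rfl
  rw [e1, e2]

/-- Chain rule for two variables. After the coordinate `U` is moved last, both terms on the right
appear in the chain rule of relative entropy for the step `(W, V) ⟶ U`, compared with the kernel
that draws `U` from its conditional law given `W` alone. -/
theorem mutualInfo_prodMk_left [StandardBorelSpace α] [Nonempty α] [StandardBorelSpace β]
    [Nonempty β] (P : Measure Ω) [IsProbabilityMeasure P] {U : Ω → α} {V : Ω → β}
    {W : Ω → γ} (hU : Measurable U) (hV : Measurable V) (hW : Measurable W) :
    mutualInfo (fun ω => (W ω, U ω)) V P = mutualInfo W V P + condMutualInfo U V W P := by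
  have : IsProbabilityMeasure (P.map W) := Measure.isProbabilityMeasure_map hW.aemeasurable
  have : IsProbabilityMeasure (P.map U) := Measure.isProbabilityMeasure_map hU.aemeasurable
  have : IsProbabilityMeasure (P.map V) := Measure.isProbabilityMeasure_map hV.aemeasurable
  have hWU := compProd_map_condDistrib (mβ := ‹_›) (μ := P) (X := W) (Y := U) (by fun_prop)
  have hWV := compProd_map_condDistrib (mβ := ‹_›) (μ := P) (X := W) (Y := V) (by fun_prop)
  have hWVU := compProd_map_condDistrib (mβ := inferInstance) (μ := P)
    (X := fun ω => (W ω, V ω)) (Y := U) (by fun_prop)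
  have h1 : mutualInfo (fun ω => (W ω, U ω)) V P =
      klDiv (P.map fun ω => ((W ω, V ω), U ω))
        (((P.map W).prod (P.map V)) ⊗ₘ Kernel.prodMkRight β (condDistrib U W P)) := by
    rw [mutualInfo, ← klDiv_map_of_leftInverse _ _
      (f := fun p : (γ × α) × β => ((p.1.1, p.2), p.1.2))
      (g := fun p : (γ × β) × α => ((p.1.1, p.2), p.1.2)) (by fun_prop) (by fun_prop)
      (fun _ => rfl), ← map_prod_compProd, hWU, Measure.map_map (by fun_prop) (by fun_prop)]
    rfl
  have h2 : condMutualInfo U V W P =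
      klDiv (P.map fun ω => ((W ω, V ω), U ω))
        ((P.map fun ω => (W ω, V ω)) ⊗ₘ Kernel.prodMkRight β (condDistrib U W P)) := by
    rw [condMutualInfo_eq_klDiv P W hU hV, ← klDiv_map_of_leftInverse _ _
      (f := fun p : γ × α × β => ((p.1, p.2.2), p.2.1))
      (g := fun p : (γ × β) × α => (p.1.1, p.2, p.1.2)) (by fun_prop) (by fun_prop)
      (fun _ => rfl), map_compProd_prod, hWV, Measure.map_map (by fun_prop) (by fun_prop)]
    rfl
  rw [h1, h2, ← hWVU, klDiv_compProd_eq_add, mutualInfo]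

end MutualInfo

/-! ### Mutual information of finite families -/

section Families

variable {Ω α β : Type*} [MeasurableSpace Ω] [MeasurableSpace α] [MeasurableSpace β]
  [StandardBorelSpace α] [StandardBorelSpace β]

/-- One step of the chain rule for a family indexed by a set, which is enlarged by one index. If the
index is already present, the conditional term vanishes, so no disjointness is needed. -/
theorem mutualInfo_insert [Nonempty α] [Nonempty β] {ι : Type*} [Countable ι]
    (P : Measure Ω) [IsProbabilityMeasure P]
    {U : ι → Ω → α} {V : Ω → β} (hU : ∀ i, Measurable (U i)) (hV : Measurable V)
    (S : Set ι) (a : ι) :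
    mutualInfo (fun ω (j : ↥(insert a S)) => U j ω) V P =
      mutualInfo (fun ω (j : S) => U j ω) V P +
        condMutualInfo (U a) V (fun ω (j : S) => U j ω) P := by
  classical
  rw [← mutualInfo_prodMk_left P (hU a) hV (by fun_prop)]
  symm
  refine mutualInfo_comp_of_leftInverse P (U := fun ω (j : ↥(insert a S)) => U j ω) (V := V)
    (f := fun x => (fun j : S => x ⟨j, Set.mem_insert_of_mem a j.2⟩, x ⟨a, Set.mem_insert a S⟩))
    (g := id) (f' := fun p j => if h : (j : ι) ∈ S then p.1 ⟨j, h⟩ else p.2) (g' := id)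
    (by fun_prop) hV (by fun_prop) measurable_id ?_ measurable_id ?_ (fun _ => rfl)
  · refine measurable_pi_lambda _ fun j => ?_
    by_cases h : (j : ι) ∈ S
    · simp only [h, dif_pos]
      fun_prop
    · simp only [h, dif_neg, not_false_eq_true]
      fun_prop
  · intro x
    funext ⟨j, hj⟩
    by_cases h : j ∈ S
    · simp [h]
    · obtain rfl : j = a := hj.resolve_right h
      simp [h]

/-- Chain rule for finitely many variables. -/
theorem mutualInfo_pi_fin_succ [Nonempty α] [Nonempty β] {n : ℕ} (P : Measure Ω)
    [IsProbabilityMeasure P]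
    {U : Fin (n + 1) → Ω → α} {V : Ω → β} (hU : ∀ i, Measurable (U i)) (hV : Measurable V) :
    mutualInfo (fun ω i => U i ω) V P = mutualInfo (U 0) V P +
      ∑ i : Fin n, condMutualInfo (U i.succ) V (fun ω (j : Set.Iio i.succ) => U j ω) P := by
  -- The initial segments `Set.Iic k` grow by one index at a time, and `Set.Iio i.succ` coincides with
  -- `Set.Iic i.castSucc`.
  have key : ∀ k : Fin (n + 1), mutualInfo (fun ω (j : Set.Iic k) => U j ω) V P =
      mutualInfo (U 0) V P + ∑ i : Fin n with i.castSucc < k,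
        condMutualInfo (U i.succ) V (fun ω (j : Set.Iio i.succ) => U j ω) P := by
    intro k
    induction k using Fin.induction with
    | zero =>
      have h0 : ∀ j : Set.Iic (0 : Fin (n + 1)), (j : Fin (n + 1)) = 0 := fun j =>
        Fin.le_zero_iff.mp j.2
      simp only [Fin.not_lt_zero, Finset.filter_false, Finset.sum_empty, add_zero]
      symm
      refine mutualInfo_comp_of_leftInverse P
        (U := fun ω (j : Set.Iic (0 : Fin (n + 1))) => U j ω) (V := V)
        (f := fun x => x ⟨0, Set.mem_Iic.mpr le_rfl⟩) (g := id) (f' := fun y _ => y) (g' := id)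
        (by fun_prop) hV (by fun_prop) measurable_id (by fun_prop) measurable_id
        (fun x => ?_) (fun _ => rfl)
      funext j
      exact congrArg x (Subtype.ext (h0 j).symm)
    | succ i ih =>
      have hset : Set.Iic i.castSucc = Set.Iio i.succ := by
        ext j
        simp [Fin.le_castSucc_iff]
      have hset' : Set.Iic i.succ = insert i.succ (Set.Iio i.succ) := by
        rw [Set.Iio_insert]
      have hfil : (Finset.univ.filter fun j : Fin n => j.castSucc < i.succ) =
          insert i (Finset.univ.filter fun j : Fin n => j.castSucc < i.castSucc) := by
        ext j
        simp [Fin.castSucc_lt_succ_iff, le_iff_eq_or_lt]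
      rw [hset', mutualInfo_insert P hU hV, ← hset, ih, hfil, Finset.sum_insert (by simp), hset,
        add_assoc, add_comm (condMutualInfo _ _ _ _)]
  have hlast := key (Fin.last n)
  have hfil : (Finset.univ.filter fun j : Fin n => j.castSucc < Fin.last n) = Finset.univ := by
    ext j
    simp [Fin.castSucc_lt_last]
  rw [hfil] at hlast
  rw [← hlast]
  exact mutualInfo_comp_of_leftInverse P
    (U := fun ω (j : Set.Iic (Fin.last n)) => U j ω) (V := V)
    (f := fun x i => x ⟨i, Set.mem_Iic.mpr (Fin.le_last i)⟩) (g := id)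
    (f' := fun y j => y j) (g' := id)
    (by fun_prop) hV (by fun_prop) measurable_id (by fun_prop) measurable_id
    (fun x => rfl) (fun _ => rfl)

/-- Mutual information is additive over independent pairs. -/
theorem mutualInfo_pi_of_iIndepFun {n : ℕ} (P : Measure Ω) [IsProbabilityMeasure P]
    {U : Fin n → Ω → α} {V : Fin n → Ω → β} (hU : ∀ i, Measurable (U i))
    (hV : ∀ i, Measurable (V i)) (h : iIndepFun (fun i ω => (U i ω, V i ω)) P) :
    mutualInfo (fun ω i => U i ω) (fun ω i => V i ω) P = ∑ i, mutualInfo (U i) (V i) P := by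
  have hUi : iIndepFun U P := h.comp (fun _ => Prod.fst) fun _ => measurable_fst
  have hVi : iIndepFun V P := h.comp (fun _ => Prod.snd) fun _ => measurable_snd
  have : ∀ i, IsProbabilityMeasure (P.map (U i)) := fun i =>
    Measure.isProbabilityMeasure_map (hU i).aemeasurable
  have : ∀ i, IsProbabilityMeasure (P.map (V i)) := fun i =>
    Measure.isProbabilityMeasure_map (hV i).aemeasurable
  have : ∀ i, IsProbabilityMeasure (P.map fun ω => (U i ω, V i ω)) := fun i =>
    Measure.isProbabilityMeasure_map (by fun_prop)
  have hjoint : P.map (fun ω => (fun i => U i ω, fun i => V i ω)) =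
      (Measure.pi fun i => P.map fun ω => (U i ω, V i ω)).map
        (MeasurableEquiv.arrowProdEquivProdArrow α β (Fin n)) := by
    rw [← (iIndepFun_iff_map_fun_eq_pi_map (by fun_prop)).mp h,
      Measure.map_map (MeasurableEquiv.measurable _) (by fun_prop)]
    rfl
  rw [mutualInfo, (iIndepFun_iff_map_fun_eq_pi_map (by fun_prop)).mp hUi,
    (iIndepFun_iff_map_fun_eq_pi_map (by fun_prop)).mp hVi, hjoint,
    ← (measurePreserving_arrowProdEquivProdArrow α β (Fin n) (fun i => P.map (U i))
      fun i => P.map (V i)).map_eq,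
    klDiv_map_of_leftInverse _ _ (MeasurableEquiv.measurable _)
      (MeasurableEquiv.arrowProdEquivProdArrow α β (Fin n)).symm.measurable
      (MeasurableEquiv.arrowProdEquivProdArrow α β (Fin n)).left_inv, klDiv_pi_fin]
  rfl

end Families

/-! ### Random directions on spheres -/

section Directions

theorem unifSph_isProbabilityMeasure {d : ℕ} (hd : 0 < d) : IsProbabilityMeasure (unifSph d) := by
  have : Nontrivial (EuclideanSpace ℝ (Fin d)) := by
    have : Nonempty (Fin d) := ⟨⟨0, hd⟩⟩
    infer_instance
  refine ⟨?_⟩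
  rw [unifSph, Measure.smul_apply, smul_eq_mul]
  refine ENNReal.inv_mul_cancel ?_ (measure_ne_top _ _)
  rw [Ne, Measure.measure_univ_eq_zero]
  exact Measure.toSphere_ne_zero _

instance unifSph_isOpenPosMeasure (d : ℕ) : (unifSph d).IsOpenPosMeasure :=
  Measure.isOpenPosMeasure_smul _ (ENNReal.inv_ne_zero.mpr (measure_ne_top _ _))

@[fun_prop]
theorem Measurable.slice {A : Type*} [MeasurableSpace A] {d : ℕ} {f : A → Sph d}
    {g : A → EuclideanSpace ℝ (Fin d)} (hf : Measurable f) (hg : Measurable g) :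
    Measurable fun a => slice (f a) (g a) :=
  (measurable_subtype_coe.comp hf).inner hg

theorem aemeasurable_comp_measurePreserving {A B : Type*} [MeasurableSpace A] [MeasurableSpace B]
    {μ : Measure A} {ν : Measure B} {g : A → B} (hg : MeasurePreserving g μ ν) {f : B → ℝ≥0∞}
    (hf : AEMeasurable f ν) : AEMeasurable (fun a => f (g a)) μ :=
  hf.comp_quasiMeasurePreserving hg.quasiMeasurePreserving

theorem lintegral_comp_measurePreserving {A B : Type*} [MeasurableSpace A] [MeasurableSpace B]
    {μ : Measure A} {ν : Measure B} {g : A → B} (hg : MeasurePreserving g μ ν) {f : B → ℝ≥0∞}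
    (hf : AEMeasurable f ν) : ∫⁻ b, f b ∂ν = ∫⁻ a, f (g a) ∂μ := by
  rw [← hg.map_eq] at hf ⊢
  exact lintegral_map' hf hg.aemeasurable

variable {A B C : Type*} [MeasurableSpace A] [MeasurableSpace B] [MeasurableSpace C]

theorem measurePreserving_rotate (μ : Measure A) (ν : Measure B) (ρ : Measure C) [SFinite μ]
    [SFinite ν] [SFinite ρ] :
    MeasurePreserving (fun p : A × B × C => (p.2.1, p.2.2, p.1)) (μ.prod (ν.prod ρ))
      (ν.prod (ρ.prod μ)) :=
  (measurePreserving_prodAssoc ν ρ μ).comp Measure.measurePreserving_swap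

theorem measurePreserving_restrict_eval {ι : Type*} [Fintype ι] {E : ι → Type*}
    [∀ i, MeasurableSpace (E i)] (μ : ∀ i, Measure (E i)) [∀ i, IsProbabilityMeasure (μ i)]
    (S : Set ι) [hS : Fintype S] {i : ι} (hi : i ∉ S) :
    MeasurePreserving (fun x : ∀ i, E i => (fun k : S => x k, x i)) (Measure.pi μ)
      ((Measure.pi fun k : S => μ k).prod (μ i)) := by
  classical
  rw [Subsingleton.elim hS (Subtype.fintype (· ∈ S))]
  have h1 := measurePreserving_piEquivPiSubtypeProd μ (fun j => j ∈ S)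
  have h2 := measurePreserving_eval (fun j : {j // j ∉ S} => μ j) ⟨i, hi⟩
  exact ((MeasurePreserving.id _).prod h2).comp h1

theorem measurePreserving_eval_eval_restrict {ι : Type*} [Fintype ι] {E : ι → Type*}
    [∀ i, MeasurableSpace (E i)] (μ : ∀ i, Measure (E i)) [∀ i, IsProbabilityMeasure (μ i)]
    (ν : Measure A) [IsProbabilityMeasure ν] (S : Set ι) [Fintype S] {i : ι} (hi : i ∉ S) :
    MeasurePreserving (fun x : (∀ i, E i) × (Unit → A) => (x.1 i, x.2 (), fun k : S => x.1 k))
      ((Measure.pi μ).prod (Measure.pi fun _ => ν))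
      ((μ i).prod (ν.prod (Measure.pi fun k : S => μ k))) :=
  (measurePreserving_rotate _ _ _).comp <| (measurePreserving_prodAssoc _ _ _).comp <|
    (measurePreserving_restrict_eval μ S hi).prod (measurePreserving_eval (fun _ : Unit => ν) ())

end Directions

/-! ### Sliced mutual information as an average over directions -/

section Sliced

variable {Ω : Type*} [MeasurableSpace Ω] (P : Measure Ω) [IsProbabilityMeasure P]

theorem slicedMI_eq_lintegral {dx dy : ℕ} {X : Ω → EuclideanSpace ℝ (Fin dx)}
    {Y : Ω → EuclideanSpace ℝ (Fin dy)} (hX : Measurable X) (hY : Measurable Y) :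
    slicedMI X Y P = ∫⁻ p, mutualInfo (fun ω => slice p.1 (X ω)) (fun ω => slice p.2 (Y ω)) P
      ∂((unifSph dx).prod (unifSph dy)) :=
  condMutualInfo_snd P _ (U := fun s : Ω × Sph dx × Sph dy => slice s.2.1 (X s.1))
    (V := fun s => slice s.2.2 (Y s.1)) (by fun_prop) (by fun_prop)

theorem measurable_mutualInfo_slice {dx dy : ℕ} {X : Ω → EuclideanSpace ℝ (Fin dx)}
    {Y : Ω → EuclideanSpace ℝ (Fin dy)} (hX : Measurable X) (hY : Measurable Y) :
    Measurable fun p : Sph dx × Sph dy =>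
      mutualInfo (fun ω => slice p.1 (X ω)) (fun ω => slice p.2 (Y ω)) P :=
  measurable_mutualInfo_section P (U := fun s : Ω × Sph dx × Sph dy => slice s.2.1 (X s.1))
    (V := fun s => slice s.2.2 (Y s.1)) (by fun_prop) (by fun_prop)

/-- A form of the Cramér–Wold device: if almost all one-dimensional projections of `X` and `Y` are
independent, then so are `X` and `Y`. By continuity of characteristic functions and the full support
of the uniform distributions, the factorization for almost all directions extends to all directions,
and every frequency vector is a multiple of a direction. -/
theorem indepFun_of_forall_slice {dx dy : ℕ} (hdx : 0 < dx) (hdy : 0 < dy)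
    {X : Ω → EuclideanSpace ℝ (Fin dx)}
    {Y : Ω → EuclideanSpace ℝ (Fin dy)} (hX : Measurable X) (hY : Measurable Y)
    (h : ∀ᵐ p ∂((unifSph dx).prod (unifSph dy)),
      IndepFun (fun ω => slice p.1 (X ω)) (fun ω => slice p.2 (Y ω)) P) : IndepFun X Y P := by
  have hjoint : IsProbabilityMeasure (P.map fun ω => WithLp.toLp 2 (X ω, Y ω)) :=
    Measure.isProbabilityMeasure_map (by fun_prop)
  have hPX : IsProbabilityMeasure (P.map X) := Measure.isProbabilityMeasure_map (by fun_prop)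
  have hPY : IsProbabilityMeasure (P.map Y) := Measure.isProbabilityMeasure_map (by fun_prop)
  -- For fixed scales `a`, `b`, both sides are continuous in the directions.
  have key : ∀ (a b : ℝ) (p : Sph dx × Sph dy),
      charFun (P.map fun ω => WithLp.toLp 2 (X ω, Y ω))
        (WithLp.toLp 2 (a • (p.1 : EuclideanSpace ℝ (Fin dx)), b • (p.2 : EuclideanSpace ℝ (Fin dy))))
      = charFun (P.map X) (a • (p.1 : EuclideanSpace ℝ (Fin dx))) *
        charFun (P.map Y) (b • (p.2 : EuclideanSpace ℝ (Fin dy))) := by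
    intro a b
    refine congrFun ((Continuous.ae_eq_iff_eq ((unifSph dx).prod (unifSph dy)) ?_ ?_).mp ?_)
    · fun_prop
    · fun_prop
    filter_upwards [h] with p hp
    have h' := (indepFun_iff_charFun_prod (by fun_prop) (by fun_prop)).mp hp (WithLp.toLp 2 (a, b))
    simp only [charFun_apply] at h' ⊢
    rw [integral_map (by fun_prop) (by fun_prop), integral_map (by fun_prop) (by fun_prop),
      integral_map (by fun_prop) (by fun_prop)] at h' ⊢
    simp only [WithLp.prod_inner_apply, slice, inner_smul_right, real_inner_comm] at h' ⊢
    simpa [mul_comm] using h'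
  have surj : ∀ {d : ℕ}, 0 < d → ∀ x : EuclideanSpace ℝ (Fin d), ∃ (a : ℝ) (θ : Sph d),
      x = a • (θ : EuclideanSpace ℝ (Fin d)) := by
    intro d hd x
    by_cases hx : x = 0
    · have : Nonempty (Fin d) := ⟨⟨0, hd⟩⟩
      obtain ⟨y, hy⟩ := exists_norm_eq (EuclideanSpace ℝ (Fin d)) zero_le_one
      exact ⟨0, ⟨y, by simpa using hy⟩, by simp [hx]⟩
    · have hx' : ‖x‖ ≠ 0 := norm_ne_zero_iff.mpr hx
      refine ⟨‖x‖, ⟨‖x‖⁻¹ • x, ?_⟩, ?_⟩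
      · simp [norm_smul, hx']
      · simp [smul_smul, hx']
  rw [indepFun_iff_charFun_prod hX.aemeasurable hY.aemeasurable]
  intro t
  obtain ⟨a, θ, hθ⟩ := surj hdx t.ofLp.1
  obtain ⟨b, φ, hφ⟩ := surj hdy t.ofLp.2
  have ht : t = WithLp.toLp 2 (a • (θ : EuclideanSpace ℝ (Fin dx)),
      b • (φ : EuclideanSpace ℝ (Fin dy))) := by
    rw [← hθ, ← hφ]
  rw [hθ, hφ, ← key a b (θ, φ), ← ht]

theorem slicedMI_eq_zero_iff {dx dy : ℕ} (hdx : 0 < dx) (hdy : 0 < dy)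
    {X : Ω → EuclideanSpace ℝ (Fin dx)}
    {Y : Ω → EuclideanSpace ℝ (Fin dy)} (hX : Measurable X) (hY : Measurable Y) :
    slicedMI X Y P = 0 ↔ IndepFun X Y P := by
  rw [slicedMI_eq_lintegral P hX hY, lintegral_eq_zero_iff (measurable_mutualInfo_slice P hX hY)]
  constructor
  · intro h
    refine indepFun_of_forall_slice P hdx hdy hX hY ?_
    filter_upwards [h] with p hp
    exact (mutualInfo_eq_zero_iff P (by fun_prop) (by fun_prop)).mp hp
  · intro h
    refine Filter.Eventually.of_forall fun p => ?_
    refine (mutualInfo_eq_zero_iff P (by fun_prop) (by fun_prop)).mpr ?_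
    exact h.comp (φ := slice p.1) (ψ := slice p.2) (by fun_prop) (by fun_prop)

/-- Conditional sliced mutual information is an average over directions; the measurability of the
integrand is needed for summing and for changing variables. -/
theorem aemeasurable_and_multiCondSlicedMI_eq_lintegral {κ : Type*} [Fintype κ] {dx dy : ℕ}
    {dz : κ → ℕ} {X : Ω → EuclideanSpace ℝ (Fin dx)} {Y : Ω → EuclideanSpace ℝ (Fin dy)}
    {Z : ∀ k, Ω → EuclideanSpace ℝ (Fin (dz k))} (hX : Measurable X) (hY : Measurable Y)
    (hZ : ∀ k, Measurable (Z k)) :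
    AEMeasurable (fun t : Sph dx × Sph dy × (∀ k, Sph (dz k)) =>
        condMutualInfo (fun ω => slice t.1 (X ω)) (fun ω => slice t.2.1 (Y ω))
          (fun ω k => slice (t.2.2 k) (Z k ω)) P)
      ((unifSph dx).prod ((unifSph dy).prod (Measure.pi fun k => unifSph (dz k)))) ∧
    multiCondSlicedMI X Y Z P = ∫⁻ t,
      condMutualInfo (fun ω => slice t.1 (X ω)) (fun ω => slice t.2.1 (Y ω))
        (fun ω k => slice (t.2.2 k) (Z k ω)) P
      ∂((unifSph dx).prod ((unifSph dy).prod (Measure.pi fun k => unifSph (dz k)))) :=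
  aemeasurable_and_condMutualInfo_snd_prodMk P _
    (U := fun s : Ω × Sph dx × Sph dy × (∀ k, Sph (dz k)) => slice s.2.1 (X s.1))
    (V := fun s => slice s.2.2.1 (Y s.1))
    (W := fun s => fun k => slice (s.2.2.2 k) (Z k s.1))
    (by fun_prop) (by fun_prop) (by fun_prop)

theorem multiSlicedMI_eq_lintegral {ι κ : Type*} [Fintype ι] [Fintype κ] {dx : ι → ℕ}
    {dy : κ → ℕ} {X : ∀ i, Ω → EuclideanSpace ℝ (Fin (dx i))}
    {Y : ∀ j, Ω → EuclideanSpace ℝ (Fin (dy j))} (hX : ∀ i, Measurable (X i))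
    (hY : ∀ j, Measurable (Y j)) :
    multiSlicedMI X Y P = ∫⁻ t, mutualInfo (fun ω i => slice (t.1 i) (X i ω))
      (fun ω j => slice (t.2 j) (Y j ω)) P
      ∂((Measure.pi fun i => unifSph (dx i)).prod (Measure.pi fun j => unifSph (dy j))) :=
  condMutualInfo_snd P _
    (U := fun s : Ω × (∀ i, Sph (dx i)) × (∀ j, Sph (dy j)) => fun i => slice (s.2.1 i) (X i s.1))
    (V := fun s => fun j => slice (s.2.2 j) (Y j s.1)) (by fun_prop) (by fun_prop)

/-- The directions that a summand does not involve are integrated out, so that all terms become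
averages over the same product of spheres and the chain rule applies to each choice of directions. -/
theorem multiSlicedMI_eq_slicedMI_add_sum {n : ℕ} {d : Fin (n + 1) → ℕ} {dy : ℕ}
    (hd : ∀ i, 0 < d i) (hdy : 0 < dy) {X : ∀ i, Ω → EuclideanSpace ℝ (Fin (d i))}
    {Y : Ω → EuclideanSpace ℝ (Fin dy)} (hX : ∀ i, Measurable (X i)) (hY : Measurable Y) :
    multiSlicedMI X (fun _ : Unit => Y) P =
      slicedMI (X 0) Y P +
        ∑ i : Fin n, multiCondSlicedMI (X i.succ) Y (fun j : Set.Iio i.succ => X j) P := by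
  have hpd : ∀ i, IsProbabilityMeasure (unifSph (d i)) := fun i =>
    unifSph_isProbabilityMeasure (hd i)
  have hpy := unifSph_isProbabilityMeasure hdy
  set τ := (Measure.pi fun i => unifSph (d i)).prod (Measure.pi fun _ : Unit => unifSph dy)
  have hmp0 : MeasurePreserving (fun t : (∀ i, Sph (d i)) × (Unit → Sph dy) => (t.1 0, t.2 ()))
      τ ((unifSph (d 0)).prod (unifSph dy)) :=
    (measurePreserving_eval (fun i => unifSph (d i)) 0).prod
      (measurePreserving_eval (fun _ : Unit => unifSph dy) ())
  have hmp : ∀ i : Fin n, MeasurePreserving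
      (fun t : (∀ i, Sph (d i)) × (Unit → Sph dy) =>
        (t.1 i.succ, t.2 (), fun k : Set.Iio i.succ => t.1 k))
      τ ((unifSph (d i.succ)).prod ((unifSph dy).prod
        (Measure.pi fun k : Set.Iio i.succ => unifSph (d k)))) := fun i =>
    measurePreserving_eval_eval_restrict (fun i => unifSph (d i)) (unifSph dy) (Set.Iio i.succ)
      (lt_irrefl i.succ)
  have hc := fun i : Fin n => aemeasurable_and_multiCondSlicedMI_eq_lintegral P (hX i.succ) hY
    (Z := fun j : Set.Iio i.succ => X j) fun j => hX j
  have hm0 := measurable_mutualInfo_slice P (hX 0) hY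
  have hf : Measurable fun t : (∀ i, Sph (d i)) × (Unit → Sph dy) =>
      mutualInfo (fun ω => slice (t.1 0) (X 0 ω)) (fun ω => slice (t.2 ()) (Y ω)) P :=
    hm0.comp hmp0.measurable
  have hg : ∀ i ∈ (Finset.univ : Finset (Fin n)),
      AEMeasurable (fun t : (∀ i, Sph (d i)) × (Unit → Sph dy) =>
        condMutualInfo (fun ω => slice (t.1 i.succ) (X i.succ ω))
          (fun ω => slice (t.2 ()) (Y ω))
          (fun ω (k : Set.Iio i.succ) => slice (t.1 k) (X k ω)) P) τ := fun i _ =>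
    aemeasurable_comp_measurePreserving (hmp i) (hc i).1
  have hsum : ∀ i : Fin n, multiCondSlicedMI (X i.succ) Y (fun j : Set.Iio i.succ => X j) P =
      ∫⁻ t, condMutualInfo (fun ω => slice (t.1 i.succ) (X i.succ ω))
        (fun ω => slice (t.2 ()) (Y ω))
        (fun ω (k : Set.Iio i.succ) => slice (t.1 k) (X k ω)) P ∂τ := fun i =>
    (hc i).2.trans (lintegral_comp_measurePreserving (hmp i) (hc i).1)
  have hsl : slicedMI (X 0) Y P = ∫⁻ t, mutualInfo (fun ω => slice (t.1 0) (X 0 ω))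
      (fun ω => slice (t.2 ()) (Y ω)) P ∂τ :=
    (slicedMI_eq_lintegral P (hX 0) hY).trans
      (lintegral_comp_measurePreserving hmp0 hm0.aemeasurable)
  rw [hsl, Finset.sum_congr rfl fun i _ => hsum i, ← lintegral_finsetSum' _ hg,
    ← lintegral_add_left hf, multiSlicedMI_eq_lintegral P hX fun _ => hY]
  refine lintegral_congr fun t => ?_
  rw [← mutualInfo_pi_fin_succ P (U := fun i ω => slice (t.1 i) (X i ω)) (by fun_prop)
    (by fun_prop)]
  exact mutualInfo_comp_of_leftInverse P (U := fun ω i => slice (t.1 i) (X i ω))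
    (V := fun ω => slice (t.2 ()) (Y ω)) (f := id) (g := fun y _ => y) (f' := id)
    (g' := fun y => y ()) (by fun_prop) (by fun_prop) measurable_id (by fun_prop) measurable_id
    (by fun_prop) (fun _ => rfl) (fun _ => rfl)

theorem jointSlicedMI_eq_add {dx dy dz : ℕ} (hdx : 0 < dx) (hdy : 0 < dy) (hdz : 0 < dz)
    {X : Ω → EuclideanSpace ℝ (Fin dx)} {Y : Ω → EuclideanSpace ℝ (Fin dy)}
    {Z : Ω → EuclideanSpace ℝ (Fin dz)} (hX : Measurable X) (hY : Measurable Y)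
    (hZ : Measurable Z) :
    jointSlicedMI X Y Z P = slicedMI X Z P + condSlicedMI Y Z X P := by
  have := unifSph_isProbabilityMeasure hdx
  have := unifSph_isProbabilityMeasure hdy
  have := unifSph_isProbabilityMeasure hdz
  have hmp : MeasurePreserving (fun t : Sph dx × Sph dy × Sph dz => (t.1, t.2.2))
      ((unifSph dx).prod ((unifSph dy).prod (unifSph dz))) ((unifSph dx).prod (unifSph dz)) :=
    (MeasurePreserving.id _).prod measurePreserving_snd
  have hc := aemeasurable_and_condMutualInfo_snd_prodMk P
    ((unifSph dy).prod ((unifSph dz).prod (unifSph dx)))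
    (U := fun s => slice s.2.1 (Y s.1)) (V := fun s => slice s.2.2.1 (Z s.1))
    (W := fun s => slice s.2.2.2 (X s.1)) (by fun_prop) (by fun_prop) (by fun_prop)
  have hm := measurable_mutualInfo_slice P hX hZ
  have hcond : condSlicedMI Y Z X P = _ := hc.2.trans
    (lintegral_comp_measurePreserving (measurePreserving_rotate _ _ _) hc.1)
  have hf : Measurable fun t : Sph dx × Sph dy × Sph dz =>
      mutualInfo (fun ω => slice t.1 (X ω)) (fun ω => slice t.2.2 (Z ω)) P :=
    hm.comp hmp.measurable
  rw [slicedMI_eq_lintegral P hX hZ, lintegral_comp_measurePreserving hmp hm.aemeasurable, hcond,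
    ← lintegral_add_left hf]
  refine (condMutualInfo_snd P _
    (U := fun s : Ω × Sph dx × Sph dy × Sph dz => (slice s.2.1 (X s.1), slice s.2.2.1 (Y s.1)))
    (V := fun s => slice s.2.2.2 (Z s.1)) (by fun_prop) (by fun_prop)).trans ?_
  exact lintegral_congr fun t => mutualInfo_prodMk_left P (U := fun ω => slice t.2.1 (Y ω))
    (V := fun ω => slice t.2.2 (Z ω)) (W := fun ω => slice t.1 (X ω)) (by fun_prop) (by fun_prop)
    (by fun_prop)

theorem multiSlicedMI_eq_sum_of_iIndepFun {n : ℕ} {dx dy : Fin n → ℕ} (hdx : ∀ i, 0 < dx i)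
    (hdy : ∀ i, 0 < dy i) {X : ∀ i, Ω → EuclideanSpace ℝ (Fin (dx i))}
    {Y : ∀ i, Ω → EuclideanSpace ℝ (Fin (dy i))} (hX : ∀ i, Measurable (X i))
    (hY : ∀ i, Measurable (Y i)) (h : iIndepFun (fun i ω => (X i ω, Y i ω)) P) :
    multiSlicedMI X Y P = ∑ i, slicedMI (X i) (Y i) P := by
  have hpx : ∀ i, IsProbabilityMeasure (unifSph (dx i)) := fun i =>
    unifSph_isProbabilityMeasure (hdx i)
  have hpy : ∀ i, IsProbabilityMeasure (unifSph (dy i)) := fun i =>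
    unifSph_isProbabilityMeasure (hdy i)
  have hmp : ∀ i, MeasurePreserving
      (fun t : (∀ i, Sph (dx i)) × (∀ i, Sph (dy i)) => (t.1 i, t.2 i))
      ((Measure.pi fun i => unifSph (dx i)).prod (Measure.pi fun i => unifSph (dy i)))
      ((unifSph (dx i)).prod (unifSph (dy i))) := fun i =>
    (measurePreserving_eval (fun i => unifSph (dx i)) i).prod
      (measurePreserving_eval (fun i => unifSph (dy i)) i)
  have hm := fun i => measurable_mutualInfo_slice P (hX i) (hY i)
  have hf : ∀ i ∈ (Finset.univ : Finset (Fin n)),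
      Measurable fun t : (∀ i, Sph (dx i)) × (∀ i, Sph (dy i)) =>
        mutualInfo (fun ω => slice (t.1 i) (X i ω)) (fun ω => slice (t.2 i) (Y i ω)) P :=
    fun i _ => (hm i).comp (hmp i).measurable
  rw [Finset.sum_congr rfl fun i _ => (slicedMI_eq_lintegral P (hX i) (hY i)).trans
    (lintegral_comp_measurePreserving (hmp i) (hm i).aemeasurable),
    ← lintegral_finsetSum _ hf, multiSlicedMI_eq_lintegral P hX hY]
  refine lintegral_congr fun t => ?_
  exact mutualInfo_pi_of_iIndepFun P (by fun_prop) (by fun_prop)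
    (h.comp (fun i p => (slice (t.1 i) p.1, slice (t.2 i) p.2)) fun i => by fun_prop)

end Sliced

/-! ### Bounds and the Kullback–Leibler form -/

section Bounds

variable {Ω : Type*} [MeasurableSpace Ω] (P : Measure Ω) [IsProbabilityMeasure P]
  {dx dy : ℕ} {X : Ω → EuclideanSpace ℝ (Fin dx)} {Y : Ω → EuclideanSpace ℝ (Fin dy)}

theorem iInf_mutualInfo_slice_le_slicedMI (hdx : 0 < dx) (hdy : 0 < dy) (hX : Measurable X)
    (hY : Measurable Y) :
    (⨅ (θ : Sph dx) (φ : Sph dy),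
      mutualInfo (fun ω => slice θ (X ω)) (fun ω => slice φ (Y ω)) P) ≤ slicedMI X Y P := by
  have := unifSph_isProbabilityMeasure hdx
  have := unifSph_isProbabilityMeasure hdy
  rw [slicedMI_eq_lintegral P hX hY]
  calc _ = ∫⁻ _, (⨅ (θ : Sph dx) (φ : Sph dy),
        mutualInfo (fun ω => slice θ (X ω)) (fun ω => slice φ (Y ω)) P)
        ∂((unifSph dx).prod (unifSph dy)) := by simp
    _ ≤ _ := lintegral_mono fun p => iInf₂_le p.1 p.2

theorem slicedMI_le_iSup_mutualInfo_slice (hdx : 0 < dx) (hdy : 0 < dy) (hX : Measurable X)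
    (hY : Measurable Y) :
    slicedMI X Y P ≤ ⨆ (θ : Sph dx) (φ : Sph dy),
      mutualInfo (fun ω => slice θ (X ω)) (fun ω => slice φ (Y ω)) P := by
  have := unifSph_isProbabilityMeasure hdx
  have := unifSph_isProbabilityMeasure hdy
  rw [slicedMI_eq_lintegral P hX hY]
  calc _ ≤ ∫⁻ _, (⨆ (θ : Sph dx) (φ : Sph dy),
        mutualInfo (fun ω => slice θ (X ω)) (fun ω => slice φ (Y ω)) P)
        ∂((unifSph dx).prod (unifSph dy)) :=
      lintegral_mono fun p => le_iSup₂ (f := fun (θ : Sph dx) (φ : Sph dy) =>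
        mutualInfo (fun ω => slice θ (X ω)) (fun ω => slice φ (Y ω)) P) p.1 p.2
    _ = _ := by simp

theorem slicedMI_eq_lintegral_klDiv (hX : Measurable X) (hY : Measurable Y) :
    slicedMI X Y P =
      ∫⁻ p, klDiv
          ((P.map (fun ω => (X ω, Y ω))).map (Prod.map (slice p.1) (slice p.2)))
          (((P.map X).map (slice p.1)).prod ((P.map Y).map (slice p.2)))
        ∂((unifSph dx).prod (unifSph dy)) := by
  rw [slicedMI_eq_lintegral P hX hY]
  refine lintegral_congr fun p => ?_
  have h1 : Measurable (slice p.1) := measurable_const.slice measurable_id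
  have h2 : Measurable (slice p.2) := measurable_const.slice measurable_id
  rw [mutualInfo, Measure.map_map (h1.prodMap h2) (by fun_prop), Measure.map_map h1 hX,
    Measure.map_map h2 hY]
  rfl

end Bounds

theorem proposition1 {Ω : Type*} [MeasurableSpace Ω] (P : Measure Ω) [IsProbabilityMeasure P] :
    -- properties of a pair `(X, Y)`
    (∀ (dx dy : ℕ), 0 < dx → 0 < dy →
      ∀ (X : Ω → EuclideanSpace ℝ (Fin dx)) (Y : Ω → EuclideanSpace ℝ (Fin dy)),
      Measurable X → Measurable Y →
        -- non-negativity, with equality iff `X` and `Y` are independent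
        (0 ≤ slicedMI X Y P ∧ (slicedMI X Y P = 0 ↔ IndepFun X Y P)) ∧
        -- bounds
        ((⨅ (θ : Sph dx) (φ : Sph dy),
            mutualInfo (fun ω => slice θ (X ω)) (fun ω => slice φ (Y ω)) P) ≤ slicedMI X Y P ∧
          slicedMI X Y P ≤ (⨆ (θ : Sph dx) (φ : Sph dy),
            mutualInfo (fun ω => slice θ (X ω)) (fun ω => slice φ (Y ω)) P) ∧
          (⨆ (θ : Sph dx) (φ : Sph dy),
            mutualInfo (fun ω => slice θ (X ω)) (fun ω => slice φ (Y ω)) P) ≤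
              mutualInfo X Y P) ∧
        -- expected KL divergence between the projected laws
        slicedMI X Y P =
          ∫⁻ p, klDiv
              ((P.map (fun ω => (X ω, Y ω))).map (Prod.map (slice p.1) (slice p.2)))
              (((P.map X).map (slice p.1)).prod ((P.map Y).map (slice p.2)))
            ∂((unifSph dx).prod (unifSph dy))) ∧
    -- chain rule for `X₁, …, Xₙ` (indexed from `0`; at least one of them) and `Y`
    (∀ (n : ℕ) (d : Fin (n + 1) → ℕ) (dy : ℕ), (∀ i, 0 < d i) → 0 < dy →
      ∀ (X : ∀ i, Ω → EuclideanSpace ℝ (Fin (d i))) (Y : Ω → EuclideanSpace ℝ (Fin dy)),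
      (∀ i, Measurable (X i)) → Measurable Y →
        multiSlicedMI X (fun _ : Unit => Y) P =
          slicedMI (X 0) Y P +
            ∑ i : Fin n, multiCondSlicedMI (X i.succ) Y (fun j : Set.Iio i.succ => X j) P) ∧
    -- chain rule for three variables
    (∀ (dx dy dz : ℕ), 0 < dx → 0 < dy → 0 < dz →
      ∀ (X : Ω → EuclideanSpace ℝ (Fin dx)) (Y : Ω → EuclideanSpace ℝ (Fin dy))
        (Z : Ω → EuclideanSpace ℝ (Fin dz)),
      Measurable X → Measurable Y → Measurable Z →
        jointSlicedMI X Y Z P = slicedMI X Z P + condSlicedMI Y Z X P) ∧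
    -- tensorization
    (∀ (n : ℕ) (dx dy : Fin n → ℕ), (∀ i, 0 < dx i) → (∀ i, 0 < dy i) →
      ∀ (X : ∀ i, Ω → EuclideanSpace ℝ (Fin (dx i))) (Y : ∀ i, Ω → EuclideanSpace ℝ (Fin (dy i))),
      (∀ i, Measurable (X i)) → (∀ i, Measurable (Y i)) →
      iIndepFun (fun i ω => (X i ω, Y i ω)) P →
        multiSlicedMI X Y P = ∑ i, slicedMI (X i) (Y i) P) := by
  refine ⟨fun dx dy hdx hdy X Y hX hY => ⟨⟨zero_le, slicedMI_eq_zero_iff P hdx hdy hX hY⟩,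
      ⟨iInf_mutualInfo_slice_le_slicedMI P hdx hdy hX hY,
        slicedMI_le_iSup_mutualInfo_slice P hdx hdy hX hY,
        iSup₂_le fun θ φ => mutualInfo_comp_le P hX hY (f := slice θ) (g := slice φ)
          (by fun_prop) (by fun_prop)⟩,
      slicedMI_eq_lintegral_klDiv P hX hY⟩,
    fun n d dy hd hdy X Y hX hY => multiSlicedMI_eq_slicedMI_add_sum P hd hdy hX hY,
    fun dx dy dz hdx hdy hdz X Y Z hX hY hZ => jointSlicedMI_eq_add P hdx hdy hdz hX hY hZ,
    fun n dx dy hdx hdy X Y hX hY h => multiSlicedMI_eq_sum_of_iIndepFun P hdx hdy hX hY h⟩
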